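/- Let $\mathbb{K}$ be an algebraically closed field of characteristic zero. A commutative algebraic monoid over $\mathbb{K}$ is an irreducible algebraic variety $S$ over $\mathbb{K}$ (not necessarily affine) with a morphism of varieties $S\times S\to S$, $(a,b)\mapsto ab$, which is associative and commutative and has a unit element. Let $G(S)$ be the group of invertible elements of $S$; it acts on $S$ by multiplication. An element $a\in S$ is called group-like if its orbit $G(S)a$ contains an idempotent, that is, an element $e$ with $e^2=e$. **Proposition.** Let $S$ be a commutative algebraic monoid over $\mathbb{K}$. Then there is a positive integer $m\le 2^{\dim S}$ such that for every $a\in S$ the element $a^m$ is group-like. -/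

import Mathlib

open AlgebraicGeometry CategoryTheory MonoidalCategory MonObj

universe u

/-- An element `a` of a monoid `M` is group-like if its orbit under the left multiplication action of
the group of invertible elements of `M` contains an idempotent. -/
def IsGroupLike {M : Type*} [Monoid M] (a : M) : Prop :=
  ∃ e ∈ MulAction.orbit Mˣ a, IsIdempotentElem e

/-- A scheme `S` over a field `K` (thought of as algebraically closed) is an irreducible algebraic
variety: it is integral (irreducible and reduced), separated and of finite type over `K`. -/
class IsIrreducibleVariety {K : Type u} [Field K] (S : Over (Spec (.of K))) : Prop where
  isIntegral : IsIntegral S.left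
  isSeparated : IsSeparated S.hom
  locallyOfFiniteType : LocallyOfFiniteType S.hom
  quasiCompact : QuasiCompact S.hom

attribute [instance] IsIrreducibleVariety.isIntegral IsIrreducibleVariety.isSeparated
  IsIrreducibleVariety.locallyOfFiniteType IsIrreducibleVariety.quasiCompact

/-- The points of a variety `S` over `K`: the morphisms `Spec K ⟶ S` over `K`. If `S` is a monoid
object, then Mathlib's instance `Hom.monoid` makes them a monoid, whose product is induced by the
multiplication morphism `μ : S ⊗ S ⟶ S` and whose unit is the unit `η` of `S`. -/
abbrev VarietyPoint {K : Type u} [Field K] (S : Over (Spec (.of K))) : Type u :=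
  𝟙_ (Over (Spec (.of K))) ⟶ S

/-! Let `ξ` be the generic point of `S`. The closures of `a ^ 2 ^ i * S` are irreducible and
decrease, so two consecutive ones agree for some `i ≤ d = dim S`. For `b = a ^ 2 ^ i`,
multiplication by `b` and by `b ^ 2` then send `ξ` to the same point. Since `ξ` lies in the image of
a family of invertible elements, there are units with `g * b = h * b ^ 2`, and `b` is group-like; so
is its power `a ^ 2 ^ d`.

That invertible elements reach `ξ` (`exists_mul_eq_one`) comes from the shearing map `(x, y) ↦ (x, x
* y)`: its fibre over `(1, 1)` is a reduced point, so it induces a surjection on the spectrum of the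
local ring there, and `(ξ, 1)` has a preimage. -/

/-! ### Endomorphisms of noetherian local rings -/

/-- A surjective endomorphism of a noetherian ring is injective. -/
lemma RingHom.injective_of_surjective_of_isNoetherianRing {A : Type*} [CommRing A]
    [IsNoetherianRing A] (f : A →+* A) (hf : Function.Surjective f) : Function.Injective f := by
  -- The kernels of the iterates stabilize at some `n`; writing `a = f ^ n b`, `f a = 0` puts `b` in
  -- the next kernel, hence `a = 0`.
  let F : ℕ →o Ideal A :=
    ⟨fun n ↦ RingHom.ker (f ^ n), monotone_nat_of_le_succ fun n x hx ↦ by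
      rw [RingHom.mem_ker] at hx ⊢
      rw [pow_succ', RingHom.mul_def, RingHom.comp_apply, hx, map_zero]⟩
  obtain ⟨n, hn⟩ := monotone_stabilizes_iff_noetherian.mpr ‹_› F
  rw [injective_iff_map_eq_zero]
  intro a ha
  have hs : Function.Surjective (f ^ n) := by
    rw [RingHom.coe_pow]
    exact hf.iterate n
  obtain ⟨b, rfl⟩ := hs a
  have hb : b ∈ F (n + 1) := by
    change (f ^ (n + 1)) b = 0
    rw [pow_succ', RingHom.mul_def, RingHom.comp_apply, ha]
  rw [← hn (n + 1) n.le_succ] at hb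
  exact hb

/-- If `f` is surjective modulo the ideal `J`, then every element of the extension of `I` is
congruent to the image of an element of `I` modulo the product with `J`. -/
lemma Ideal.exists_sub_mem_map_mul {A B : Type*} [CommRing A] [CommRing B] (f : A →+* B)
    (J : Ideal B) (hJ : ∀ c, ∃ b, c - f b ∈ J) (I : Ideal A) {x : B} (hx : x ∈ I.map f) :
    ∃ i ∈ I, x - f i ∈ I.map f * J := by
  induction hx using Submodule.span_induction with
  | mem x h =>
    obtain ⟨i, hi, rfl⟩ := h
    exact ⟨i, hi, by simp⟩
  | zero => exact ⟨0, I.zero_mem, by simp⟩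
  | add x y _ _ hx hy =>
    obtain ⟨i, hi, hxi⟩ := hx
    obtain ⟨j, hj, hyj⟩ := hy
    refine ⟨i + j, I.add_mem hi hj, ?_⟩
    rw [map_add, add_sub_add_comm]
    exact Ideal.add_mem _ hxi hyj
  | smul c x _ hx =>
    obtain ⟨i, hi, hxi⟩ := hx
    obtain ⟨b, hb⟩ := hJ c
    refine ⟨b * i, I.mul_mem_left b hi, ?_⟩
    have : c • x - f (b * i) = c * (x - f i) + f i * (c - f b) := by
      rw [smul_eq_mul, map_mul]; ring
    rw [this]
    exact Ideal.add_mem _ (Ideal.mul_mem_left _ _ hxi)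
      (Ideal.mul_mem_mul (Ideal.mem_map_of_mem f hi) hb)

section LocalEndomorphism

variable {A : Type*} [CommRing A] [IsLocalRing A] (f : A →+* A)

open IsLocalRing

/-- A ring endomorphism `f` of a local ring is surjective modulo all powers of the maximal ideal `m`
as soon as it is so modulo `m`, and `m` is generated by `f m`. -/
lemma IsLocalRing.exists_sub_mem_maximalIdeal_pow
    (h₁ : ∀ a, ∃ b, a - f b ∈ maximalIdeal A)
    (h₂ : maximalIdeal A ≤ (maximalIdeal A).map f)
    (h₃ : (maximalIdeal A).map f ≤ maximalIdeal A) (n : ℕ) (a : A) :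
    ∃ b, a - f b ∈ maximalIdeal A ^ n := by
  induction n with
  | zero => exact ⟨0, by simp⟩
  | succ n ih =>
    obtain ⟨b, hb⟩ := ih
    have hmap : (maximalIdeal A ^ n).map f = maximalIdeal A ^ n := by
      rw [Ideal.map_pow, le_antisymm h₃ h₂]
    -- The error `a - f b` lies in the extension of `m ^ n`, so some `f c` corrects it modulo `m ^ n
    -- * m`.
    obtain ⟨c, -, hc⟩ := Ideal.exists_sub_mem_map_mul f _ h₁ (maximalIdeal A ^ n)
      (hmap.symm ▸ hb)
    refine ⟨b + c, ?_⟩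
    rwa [hmap, ← pow_succ, sub_sub, ← map_add] at hc

variable [IsNoetherianRing A]

/-- An element of a noetherian local ring that lies in `I + m ^ n` for all `n` lies in `I`. -/
lemma IsLocalRing.mem_of_forall_exists_sub_mem_maximalIdeal_pow (I : Ideal A) {a : A}
    (h : ∀ n, ∃ i ∈ I, a - i ∈ maximalIdeal A ^ n) : a ∈ I := by
  -- Krull's intersection theorem for the module `A ⧸ I`.
  rw [← Ideal.Quotient.eq_zero_iff_mem, ← Submodule.mem_bot A,
    ← Ideal.iInf_pow_smul_eq_bot_of_isLocalRing (M := A ⧸ I) _ (maximalIdeal.isMaximal A).ne_top,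
    Submodule.mem_iInf]
  intro n
  obtain ⟨i, hi, hn⟩ := h n
  have : Ideal.Quotient.mk I a = (a - i) • (1 : A ⧸ I) := by
    rw [Algebra.smul_def, _root_.mul_one, Ideal.Quotient.algebraMap_eq, map_sub,
      Ideal.Quotient.eq_zero_iff_mem.mpr hi, sub_zero]
  rw [this]
  exact Submodule.smul_mem_smul hn trivial

/-- If an endomorphism `f` of a noetherian ring maps an ideal `I` into itself and is surjective
modulo `I`, then `f` is injective modulo `I`. -/
lemma RingHom.mem_of_map_mem_of_surjective_mod {A : Type*} [CommRing A] [IsNoetherianRing A]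
    (f : A →+* A) (I : Ideal A) (hI : I ≤ I.comap f) (hs : ∀ a, ∃ b, a - f b ∈ I) {a : A}
    (ha : f a ∈ I) : a ∈ I := by
  have hinj := RingHom.injective_of_surjective_of_isNoetherianRing
    (Ideal.quotientMap I f hI) fun x ↦ by
      obtain ⟨x, rfl⟩ := Ideal.Quotient.mk_surjective x
      obtain ⟨b, hb⟩ := hs x
      exact ⟨Ideal.Quotient.mk _ b, by
        rw [Ideal.quotientMap_mk]; exact (Ideal.Quotient.eq.mpr hb).symm⟩
  rw [← Ideal.Quotient.eq_zero_iff_mem] at ha ⊢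
  apply hinj
  rw [Ideal.quotientMap_mk, ha, map_zero]

/-- An endomorphism `f` of a noetherian local ring with maximal ideal `m` that is surjective
modulo `m`, and such that `f m` generates `m`, induces a surjection on spectra. -/
lemma IsLocalRing.comap_surjective_of_map_maximalIdeal
    (h₁ : ∀ a, ∃ b, a - f b ∈ maximalIdeal A)
    (h₂ : maximalIdeal A ≤ (maximalIdeal A).map f)
    (h₃ : (maximalIdeal A).map f ≤ maximalIdeal A) :
    Function.Surjective (PrimeSpectrum.comap f) := by
  have hs := IsLocalRing.exists_sub_mem_maximalIdeal_pow f h₁ h₂ h₃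
  have hle (n : ℕ) : maximalIdeal A ^ n ≤ (maximalIdeal A ^ n).comap f := by
    rw [← Ideal.map_le_iff_le_comap, Ideal.map_pow]
    exact Ideal.pow_right_mono h₃ n
  -- Every ideal is the contraction of its extension; for a prime this gives a prime lying over it.
  have hc (I : Ideal A) {a : A} (ha : f a ∈ I.map f) : a ∈ I := by
    refine IsLocalRing.mem_of_forall_exists_sub_mem_maximalIdeal_pow I fun n ↦ ?_
    obtain ⟨i, hip, hin⟩ := Ideal.exists_sub_mem_map_mul f _ (hs n) I ha
    refine ⟨i, hip, RingHom.mem_of_map_mem_of_surjective_mod f _ (hle n) (hs n) ?_⟩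
    rw [map_sub]
    exact Ideal.mul_le_right hin
  intro p
  exact (PrimeSpectrum.mem_range_comap_iff f).mpr
    (le_antisymm (fun a ha ↦ hc p.asIdeal ha) Ideal.le_comap_map)

/-- Let `f` be an endomorphism of a noetherian local `K`-algebra `A` with residue field `K`. If the
fibre of `f` over the closed point is the reduced closed point, then `f` induces a surjection on
spectra. -/
lemma IsLocalRing.comap_surjective_of_fiber {K : Type*} [Field K] (π : A →+* K) (κ : K →+* A)
    (hκ : π.comp κ = .id K) (hfκ : f.comp κ = κ) (hπf : π.comp f = π)
    (H : ∀ J : Ideal A, (Ideal.Quotient.mk J).comp f = (Ideal.Quotient.mk J).comp (κ.comp π) →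
      Ideal.Quotient.mk J = (Ideal.Quotient.mk J).comp (κ.comp π)) :
    Function.Surjective (PrimeSpectrum.comap f) := by
  have hκ' (c : K) : π (κ c) = c := congr($hκ c)
  have hfκ' (c : K) : f (κ c) = κ c := congr($hfκ c)
  have hπf' (a : A) : π (f a) = π a := congr($hπf a)
  have hker : RingHom.ker π = maximalIdeal A :=
    IsLocalRing.eq_maximalIdeal (RingHom.ker_isMaximal_of_surjective π fun c ↦ ⟨κ c, hκ' c⟩)
  have hsub (a : A) : a - κ (π a) ∈ maximalIdeal A := by
    rw [← hker, RingHom.mem_ker, map_sub, hκ', sub_self]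
  refine IsLocalRing.comap_surjective_of_map_maximalIdeal f (fun a ↦ ⟨κ (π a), ?_⟩) ?_ ?_
  · rw [hfκ']
    exact hsub a
  -- This quotient is the coordinate ring of the fibre over the closed point.
  · have := H ((maximalIdeal A).map f) (by
      ext a
      simp only [RingHom.comp_apply]
      rw [Ideal.Quotient.eq, ← hfκ', ← map_sub]
      exact Ideal.mem_map_of_mem f (hsub a))
    intro a ha
    have h0 := congr($this a)
    rw [← hker, RingHom.mem_ker] at ha
    simpa [ha, Ideal.Quotient.eq_zero_iff_mem] using h0
  · rw [Ideal.map_le_iff_le_comap, ← hker]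
    intro a ha
    rw [RingHom.mem_ker] at ha
    rw [Ideal.mem_comap, RingHom.mem_ker, hπf', ha]

end LocalEndomorphism

/-! ### From local rings to schemes -/

/-- A morphism from the spectrum of a local ring factors through the spectrum of the local ring at
the image of the closed point. -/
lemma AlgebraicGeometry.Scheme.exists_specMap_comp_fromSpecStalk {X : Scheme.{u}}
    {R : CommRingCat.{u}} [IsLocalRing R] (g : Spec R ⟶ X) {x : X}
    (hx : g (IsLocalRing.closedPoint R) = x) :
    ∃ h : X.presheaf.stalk x ⟶ R, Spec.map h ≫ X.fromSpecStalk x = g := by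
  subst hx
  exact ⟨_, Scheme.Spec_stalkClosedPointTo_fromSpecStalk g⟩

/-- If the fibre of an endomorphism `φ` of a `K`-scheme over a fixed `K`-point `p` is the reduced
point `p`, then the image of `φ` contains all generizations of `p`. -/
lemma AlgebraicGeometry.Scheme.mem_range_of_specializes_of_fiber {K : Type u} [Field K]
    {X : Scheme.{u}} [IsLocallyNoetherian X] (s : X ⟶ Spec (.of K)) (φ : X ⟶ X)
    (p : Spec (.of K) ⟶ X) (hps : p ≫ s = 𝟙 _) (hφs : φ ≫ s = s) (hpφ : p ≫ φ = p)
    (H : ∀ (R : CommRingCat.{u}) (t : Spec R ⟶ X), t ≫ φ = t ≫ s ≫ p → t = t ≫ s ≫ p)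
    {y : X} (hy : y ⤳ p (IsLocalRing.closedPoint K)) : y ∈ Set.range φ := by
  set x : X := p (IsLocalRing.closedPoint K) with hx
  let j := X.fromSpecStalk x
  have hj : j (IsLocalRing.closedPoint _) = x := Scheme.fromSpecStalk_closedPoint
  obtain ⟨π, hπ⟩ := Scheme.exists_specMap_comp_fromSpecStalk p hx.symm
  obtain ⟨f, hf⟩ := Scheme.exists_specMap_comp_fromSpecStalk (j ≫ φ) (x := x) (by
    exact congr(φ $hj).trans congr($hpφ (IsLocalRing.closedPoint K)))
  change Spec.map π ≫ j = p at hπ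
  change Spec.map f ≫ j = j ≫ φ at hf
  let κ : .of K ⟶ X.presheaf.stalk x := Spec.preimage (j ≫ s)
  have hκ : Spec.map κ = j ≫ s := Spec.map_preimage _
  have hsurj := IsLocalRing.comap_surjective_of_fiber f.hom π.hom κ.hom
    (by
      rw [← CommRingCat.hom_comp, ← CommRingCat.hom_id]
      congr 1
      apply Spec.map_injective
      rw [Spec.map_comp, hκ, reassoc_of% hπ, hps, Spec.map_id])
    (by
      rw [← CommRingCat.hom_comp]
      congr 1
      apply Spec.map_injective
      rw [Spec.map_comp, hκ, reassoc_of% hf, hφs])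
    (by
      rw [← CommRingCat.hom_comp]
      congr 1
      apply Spec.map_injective
      rw [← cancel_mono j, Spec.map_comp, Category.assoc, hf, reassoc_of% hπ, hπ, hpφ])
    (fun J hJ ↦ by
      let q : X.presheaf.stalk x ⟶ .of (X.presheaf.stalk x ⧸ J) :=
        CommRingCat.ofHom (Ideal.Quotient.mk J)
      have h₁ : f ≫ q = π ≫ κ ≫ q := CommRingCat.hom_ext hJ
      have h₂ : Spec.map (π ≫ κ ≫ q) ≫ j = (Spec.map q ≫ j) ≫ s ≫ p := by
        simp only [Spec.map_comp, Category.assoc, hπ, reassoc_of% hκ]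
      have h₃ := H _ (Spec.map q ≫ j) (by
        rw [← h₂, ← h₁, Spec.map_comp, Category.assoc, Category.assoc, hf])
      rw [← h₂, cancel_mono] at h₃
      exact congr(($(Spec.map_injective h₃)).hom))
  obtain ⟨z, rfl⟩ := Scheme.range_fromSpecStalk.ge hy
  obtain ⟨w, rfl⟩ := hsurj z
  exact ⟨j w, congr($hf.symm w)⟩

/-! ### The shearing map and invertible elements -/

section Monoid

open CartesianMonoidalCategory

variable {K : Type u} [Field K] (S : Over (Spec (.of K))) [MonObj S]

/-- The shearing endomorphism `(x, y) ↦ (x, x * y)` of the square of a monoid object. -/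
noncomputable def shearing : S ⊗ S ⟶ S ⊗ S := lift (fst S S) μ

/-- The morphism `x ↦ (x, 1)`. -/
noncomputable def pairOne : S ⟶ S ⊗ S := lift (𝟙 S) 1

variable {S}

/-- The scheme-theoretic fibre of the shearing endomorphism over `(1, 1)` is the point `(1, 1)`. -/
lemma eq_one_of_comp_shearing {T : Over (Spec (.of K))} (t : T ⟶ S ⊗ S)
    (ht : t ≫ shearing S = lift 1 1) : t = lift 1 1 := by
  have h₁ : t ≫ fst S S = 1 := by simpa [shearing] using congr($ht ≫ fst S S)
  have h₂ : t ≫ μ = 1 := by simpa [shearing] using congr($ht ≫ snd S S)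
  have h₃ : (t ≫ fst S S) * (t ≫ snd S S) = t ≫ μ := by
    rw [Hom.mul_def, lift_comp_fst_snd]
  rw [h₁, h₂, _root_.one_mul] at h₃
  ext1
  · simpa using h₁
  · simpa using h₃

/-- Multiplication of a variety by one of its points. -/
noncomputable def mulPoint (a : VarietyPoint S) : S ⟶ S := 𝟙 S * (toUnit S ≫ a)

lemma comp_mulPoint {T : Over (Spec (.of K))} (t : T ⟶ S) (a : VarietyPoint S) :
    t ≫ mulPoint a = t * (toUnit T ≫ a) := by
  rw [mulPoint, comp_mul, Category.comp_id, comp_toUnit_assoc]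

lemma mulPoint_mul (a b : VarietyPoint S) : mulPoint (a * b) = mulPoint a ≫ mulPoint b := by
  rw [comp_mulPoint, mulPoint, mulPoint, comp_mul, _root_.mul_assoc]

variable [LocallyOfFiniteType S.hom]

instance : LocallyOfFiniteType (S ⊗ S).hom := by
  rw [Over.tensorObj_hom]; infer_instance

instance : IsLocallyNoetherian (S ⊗ S).left :=
  LocallyOfFiniteType.isLocallyNoetherian (Y := Spec (.of K)) (S ⊗ S).hom

/-- The image of the shearing endomorphism contains `(x, 1)` for every generization `x` of the
unit. -/
lemma mem_range_shearing {x : S.left}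
    (hx : x ⤳ (η[S] : 𝟙_ _ ⟶ S).left (IsLocalRing.closedPoint K)) :
    (pairOne S).left x ∈ Set.range (shearing S).left := by
  let p : 𝟙_ (Over (Spec (.of K))) ⟶ S ⊗ S := lift 1 1
  have hη : η[S] = 1 := by
    rw [Hom.one_def, toUnit_unique (toUnit _) (𝟙 _), Category.id_comp]
  have hp : η[S] ≫ pairOne S = p := by
    rw [pairOne, comp_lift, Category.comp_id, comp_one, hη]
  have hpp : p ≫ shearing S = p := by
    ext1
    · simp [shearing, p]
    · simp [shearing, p, ← Hom.mul_def]
  refine Scheme.mem_range_of_specializes_of_fiber (S ⊗ S).hom (shearing S).left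
    p.left (Over.w p) (Over.w _) congr(($hpp).left) ?_ ?_
  · intro R t ht
    let t' : Over.mk (t ≫ (S ⊗ S).hom) ⟶ S ⊗ S := Over.homMk t
    have h : toUnit (Over.mk (t ≫ (S ⊗ S).hom)) ≫ p = lift 1 1 := by
      rw [comp_lift, comp_one]
    have hl : (toUnit (Over.mk (t ≫ (S ⊗ S).hom)) ≫ p).left = t ≫ (S ⊗ S).hom ≫ p.left := by
      rw [Over.comp_left, Over.toUnit_left]
      exact Category.assoc _ _ _
    have := eq_one_of_comp_shearing t' (by
      rw [← h]
      refine Over.OverMorphism.ext ?_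
      rw [hl]
      exact ht)
    rw [← h] at this
    rw [← hl]
    exact congr(($this).left)
  · rw [← hp]
    exact hx.map (pairOne S).left.continuous

/-- For every generization `ξ` of the unit of `S` there are a scheme `G` locally of finite type and
morphisms `x` and `y` from `G` to `S`, inverse to each other, such that the image of `x` contains
`ξ`. -/
lemma exists_mul_eq_one {ξ : S.left}
    (hx : ξ ⤳ (η[S] : 𝟙_ _ ⟶ S).left (IsLocalRing.closedPoint K)) :
    ∃ (G : Over (Spec (.of K))) (x y : G ⟶ S), LocallyOfFiniteType G.hom ∧ x * y = 1 ∧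
      ξ ∈ Set.range x.left := by
  obtain ⟨w, hw⟩ := mem_range_shearing hx
  have : LocallyOfFiniteType ((shearing S).left ≫ (S ⊗ S).hom) := by
    rw [Over.w]; infer_instance
  have : LocallyOfFiniteType (shearing S).left := locallyOfFiniteType_of_comp _ (S ⊗ S).hom
  -- `G` parametrizes the pairs `(x, y)` with `x * y = 1`.
  let G : Over (Spec (.of K)) :=
    Over.mk (Limits.pullback.snd (shearing S).left (pairOne S).left ≫ S.hom)
  let x : G ⟶ S := Over.homMk (Limits.pullback.snd (shearing S).left (pairOne S).left)
  let u : G ⟶ S ⊗ S := Over.homMk (Limits.pullback.fst (shearing S).left (pairOne S).left) (by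
    rw [← Over.w (shearing S), Limits.pullback.condition_assoc, Over.w]
    rfl)
  have hu : u ≫ shearing S = x ≫ pairOne S := by
    exact Over.OverMorphism.ext Limits.pullback.condition
  have h₁ : u ≫ fst S S = x := by simpa [shearing, pairOne] using congr($hu ≫ fst S S)
  have h₂ : u ≫ μ = 1 := by simpa [shearing, pairOne] using congr($hu ≫ snd S S)
  refine ⟨G, x, u ≫ snd S S, ?_, ?_, ?_⟩
  · dsimp [G]; infer_instance
  · rw [← h₁, ← h₂, Hom.mul_def, lift_comp_fst_snd]
  · obtain ⟨z, -, hz⟩ := Scheme.Pullback.exists_preimage_pullback w ξ hw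
    exact ⟨z, hz⟩

end Monoid

/-- With `u = g⁻¹ * h` one has `a = u * a ^ 2`, so `(u * a) ^ 2 = u * (u * a ^ 2) = u * a`. -/
lemma isGroupLike_of_mul_eq_mul_sq {M : Type*} [CommMonoid M] {a : M} (g h : Mˣ)
    (H : g * a = h * a ^ 2) : IsGroupLike a := by
  refine ⟨(g⁻¹ * h) • a, ⟨_, rfl⟩, ?_⟩
  have ha : a = (g⁻¹ * h) • a ^ 2 := by
    rw [mul_smul, Units.smul_def h, smul_eq_mul, ← H, ← smul_eq_mul (g : M), ← Units.smul_def,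
      inv_smul_smul]
  rw [IsIdempotentElem, smul_mul_smul_comm, mul_smul, ← pow_two, ← ha]

/-! ### Rational points and the group-likeness criterion -/

section AlgClosed

open CartesianMonoidalCategory

variable {K : Type u} [Field K] [IsAlgClosed K]

/-- A nonempty scheme locally of finite type over an algebraically closed field has a rational
point. -/
lemma exists_varietyPoint (X : Over (Spec (.of K))) [LocallyOfFiniteType X.hom]
    [Nonempty X.left] : Nonempty (VarietyPoint X) := by
  have : JacobsonSpace X.left := LocallyOfFiniteType.jacobsonSpace (Y := Spec (.of K)) X.hom
  obtain ⟨x, -, hx⟩ := nonempty_inter_closedPoints (X := X.left) Set.univ_nonempty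
    isOpen_univ.isLocallyClosed
  exact ⟨Over.homMk (pointOfClosedPoint X.hom x hx) (pointOfClosedPoint_comp X.hom x hx)⟩

/-- If the images of two morphisms to `S` meet, then they meet in a `K`-point. -/
lemma exists_comp_eq_comp {G H S : Over (Spec (.of K))} [LocallyOfFiniteType S.hom]
    [LocallyOfFiniteType G.hom] [LocallyOfFiniteType H.hom] (f : G ⟶ S) (g : H ⟶ S)
    {x : G.left} {y : H.left} (h : f.left x = g.left y) :
    ∃ (a : VarietyPoint G) (b : VarietyPoint H), a ≫ f = b ≫ g := by
  have : LocallyOfFiniteType (g.left ≫ S.hom) := by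
    rw [Over.w]; infer_instance
  have : LocallyOfFiniteType g.left := locallyOfFiniteType_of_comp _ S.hom
  let P : Over (Spec (.of K)) := Over.mk (Limits.pullback.fst f.left g.left ≫ G.hom)
  have : LocallyOfFiniteType P.hom := by dsimp [P]; infer_instance
  obtain ⟨z, -, -⟩ := Scheme.Pullback.exists_preimage_pullback x y h
  have : Nonempty P.left := ⟨z⟩
  obtain ⟨c⟩ := exists_varietyPoint P
  let u : P ⟶ G := Over.homMk (Limits.pullback.fst _ _)
  let v : P ⟶ H := Over.homMk (Limits.pullback.snd _ _) (by
    rw [← Over.w g, ← Limits.pullback.condition_assoc, Over.w]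
    rfl)
  have huv : u ≫ f = v ≫ g := by
    exact Over.OverMorphism.ext Limits.pullback.condition
  exact ⟨c ≫ u, c ≫ v, by simp [huv]⟩

variable {S : Over (Spec (.of K))} [MonObj S] [LocallyOfFiniteType S.hom] [IsCommMonObj S]

/-- If multiplication by `a` and by `a ^ 2` agree at a generization of the unit, then `a` is
group-like. -/
lemma isGroupLike_of_mulPoint_apply_eq {ξ : S.left}
    (hξ : ξ ⤳ (η[S] : 𝟙_ _ ⟶ S).left (IsLocalRing.closedPoint K)) (a : VarietyPoint S)
    (ha : (mulPoint a).left ξ = (mulPoint (a ^ 2)).left ξ) : IsGroupLike a := by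
  obtain ⟨G, x, y, _, hxy, z, rfl⟩ := exists_mul_eq_one hξ
  -- The coincidence at `z` is only one of scheme points, so the `K`-points `g` and `h` may differ.
  obtain ⟨g, h, H⟩ := exists_comp_eq_comp (x ≫ mulPoint a) (x ≫ mulPoint (a ^ 2)) (x := z) (y := z)
    (by simpa using ha)
  have hu (g : VarietyPoint G) : IsUnit (g ≫ x) :=
    .of_mul_eq_one (g ≫ y) (by rw [← comp_mul, hxy, comp_one])
  obtain ⟨g', hg'⟩ := hu g
  obtain ⟨h', hh'⟩ := hu h
  refine isGroupLike_of_mul_eq_mul_sq g' h' ?_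
  rw [hg', hh']
  have hid : toUnit (𝟙_ (Over (Spec (.of K)))) = 𝟙 _ := toUnit_unique _ _
  rwa [← Category.assoc, ← Category.assoc, comp_mulPoint, comp_mulPoint, hid, Category.id_comp,
    Category.id_comp] at H

end AlgClosed

/-! ### Krull dimension -/

/-- An algebra of finite type over a field has finite Krull dimension. -/
lemma RingHom.FiniteType.ringKrullDim_lt_top {K R : Type*} [Field K] [CommRing R] {f : K →+* R}
    (hf : f.FiniteType) : ringKrullDim R < ⊤ := by
  algebraize [f]
  obtain ⟨n, g, hg⟩ := Algebra.FiniteType.iff_quotient_mvPolynomial''.mp hf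
  refine (ringKrullDim_le_of_surjective g.toRingHom hg).trans_lt ?_
  rw [MvPolynomial.ringKrullDim_of_isNoetherianRing, ringKrullDim_eq_zero_of_field, zero_add,
    Nat.card_fin]
  exact WithBot.coe_lt_coe.mpr (ENat.natCast_lt_top n)

/-- An affine scheme of finite type over a field has finite Krull dimension. -/
lemma AlgebraicGeometry.Scheme.topologicalKrullDim_lt_top_of_isAffine {K : Type u} [Field K]
    {X : Scheme.{u}} [IsAffine X] (f : X ⟶ Spec (.of K)) [LocallyOfFiniteType f] :
    topologicalKrullDim X < ⊤ := by
  obtain ⟨φ, hφ⟩ := Spec.map_surjective (X.isoSpec.inv ≫ f)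
  have : LocallyOfFiniteType (Spec.map φ) := by
    rw [hφ]; infer_instance
  rw [HasRingHomProperty.Spec_iff (P := @LocallyOfFiniteType)] at this
  rw [IsHomeomorph.topologicalKrullDim_eq _ X.isoSpec.hom.homeomorph.isHomeomorph]
  exact (PrimeSpectrum.topologicalKrullDim_eq_ringKrullDim _).trans_lt this.ringKrullDim_lt_top

open TopologicalSpace in
/-- The Krull dimension of a space with a finite open cover is bounded by the dimensions of the
members of the cover. -/
lemma topologicalKrullDim_le_sup_of_isOpenEmbedding {X I : Type*} [TopologicalSpace X] [Fintype I]
    {U : I → Type*} [∀ i, TopologicalSpace (U i)] (f : ∀ i, U i → X)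
    (hf : ∀ i, Topology.IsOpenEmbedding (f i)) (hU : ∀ x, ∃ i, x ∈ Set.range (f i)) :
    topologicalKrullDim X ≤ Finset.univ.sup fun i ↦ topologicalKrullDim (U i) := by
  rw [topologicalKrullDim, Order.krullDim_eq_iSup_coheight]
  refine iSup_le fun Z ↦ ?_
  obtain ⟨x, hx⟩ := Z.isIrreducible.nonempty
  obtain ⟨i, y, rfl⟩ := hU x
  let e := IrreducibleCloseds.orderIsoOfIsOpenEmbedding (f i) (hf i)
  have hZ : IrreducibleCloseds.map (f i) (hf i).continuous (e.symm ⟨Z, y, hx⟩) = Z :=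
    congr(($(e.apply_symm_apply ⟨Z, y, hx⟩)).1)
  -- Chains above `Z` consist of sets that all meet the image of `U i`, so the coheight can be
  -- computed in `U i`.
  rw [← hZ, (hf i).coheight_map]
  exact (Order.coheight_le_krullDim _).trans
    (Finset.le_sup (f := fun i ↦ topologicalKrullDim (U i)) (Finset.mem_univ i))

/-- A scheme of finite type over a field has finite Krull dimension. -/
lemma AlgebraicGeometry.Scheme.topologicalKrullDim_lt_top {K : Type u} [Field K] {X : Scheme.{u}}
    (f : X ⟶ Spec (.of K)) [LocallyOfFiniteType f] [QuasiCompact f] :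
    topologicalKrullDim X < ⊤ := by
  have : CompactSpace X := QuasiCompact.compactSpace_of_compactSpace f
  let 𝒰 := X.affineCover.finiteSubcover
  have (i : 𝒰.I₀) : IsAffine (𝒰.X i) := isAffine_Spec _
  refine (topologicalKrullDim_le_sup_of_isOpenEmbedding (fun i ↦ 𝒰.f i)
    (fun i ↦ (𝒰.f i).isOpenEmbedding) fun x ↦ ⟨_, 𝒰.covers x⟩).trans_lt ?_
  rw [Finset.sup_lt_iff (by exact bot_lt_top)]
  exact fun i _ ↦ topologicalKrullDim_lt_top_of_isAffine (𝒰.f i ≫ f)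

open TopologicalSpace in
/-- The length of a strictly decreasing sequence of irreducible closed sets is bounded by the
dimension. -/
lemma exists_eq_of_topologicalKrullDim_eq {X : Type*} [TopologicalSpace X] {d : ℕ}
    (hd : topologicalKrullDim X = d) (Z : ℕ → IrreducibleCloseds X) (hZ : Antitone Z) :
    ∃ i ≤ d, Z (i + 1) = Z i := by
  by_contra! H
  -- The `d + 2` sets `Z 0, ..., Z (d + 1)` would form a strict chain of length `d + 1`.
  let s : LTSeries (IrreducibleCloseds X)ᵒᵈ :=
    { length := d + 1
      toFun i := OrderDual.toDual (Z i)
      step i := OrderDual.toDual_lt_toDual.mpr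
        (lt_of_le_of_ne (hZ (by simp)) (fun h ↦ H i (by omega) h.symm)) }
  have := Order.LTSeries.length_le_krullDim s
  rw [Order.krullDim_orderDual, ← topologicalKrullDim, hd] at this
  have h : d + 1 ≤ d := by exact_mod_cast this
  omega

/-! ### Descending chain of images and conclusion -/

lemma IsGroupLike.pow {M : Type*} [CommMonoid M] {a : M} (ha : IsGroupLike a) (n : ℕ) :
    IsGroupLike (a ^ n) := by
  obtain ⟨_, ⟨g, rfl⟩, hg⟩ := ha
  refine ⟨_, ⟨g ^ n, rfl⟩, ?_⟩
  change IsIdempotentElem (g ^ n • a ^ n)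
  rw [← smul_pow]
  exact hg.pow n

/-- The closure of the image of a variety under the multiplication by a point, as the closure of
the image of a dense point. -/
noncomputable def closureMulPoint {K : Type u} [Field K] {S : Over (Spec (.of K))} [MonObj S]
    (ξ : S.left) (a : VarietyPoint S) : TopologicalSpace.IrreducibleCloseds S.left where
  carrier := closure {(mulPoint a).left ξ}
  isIrreducible' := isIrreducible_singleton.closure
  isClosed' := isClosed_closure

/-- Multiplication by `a` is continuous, so it preserves the specialization of `ξ` to its image
under `a`. -/
lemma closureMulPoint_mul_self_le {K : Type u} [Field K] {S : Over (Spec (.of K))} [MonObj S]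
    {ξ : S.left} (hξ : ∀ x, ξ ⤳ x) (a : VarietyPoint S) :
    closureMulPoint ξ (a * a) ≤ closureMulPoint ξ a := by
  have : (mulPoint a).left ξ ⤳ (mulPoint (a * a)).left ξ := by
    have h : (mulPoint (a * a)).left ξ = (mulPoint a).left ((mulPoint a).left ξ) := by
      rw [mulPoint_mul, Over.comp_left, Scheme.Hom.comp_apply]
    rw [h]
    exact (hξ _).map (mulPoint a).left.continuous
  exact this.closure_subset

theorem proposition6p2 {K : Type u} [Field K] [IsAlgClosed K] [CharZero K]
    (S : Over (Spec (.of K))) [IsIrreducibleVariety S] [MonObj S] [IsCommMonObj S] :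
    ∃ d : ℕ, topologicalKrullDim S.left = d ∧
      ∃ m : ℕ, 0 < m ∧ m ≤ 2 ^ d ∧ ∀ a : VarietyPoint S, IsGroupLike (a ^ m) := by
  let ξ := genericPoint S.left
  have hξ (x : S.left) : ξ ⤳ x := genericPoint_specializes x
  obtain ⟨d, hd⟩ : ∃ d : ℕ, topologicalKrullDim S.left = d := by
    have htop := (Scheme.topologicalKrullDim_lt_top S.hom).ne
    have hbot : topologicalKrullDim S.left ≠ ⊥ := by
      have : Nonempty (TopologicalSpace.IrreducibleCloseds S.left) :=
        ⟨⟨closure {ξ}, isIrreducible_singleton.closure, isClosed_closure⟩⟩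
      exact Order.krullDim_ne_bot_iff.mpr this
    obtain ⟨e, he⟩ := WithBot.ne_bot_iff_exists.mp hbot
    rw [← he] at htop ⊢
    lift e to ℕ using fun h ↦ htop (congrArg _ h)
    exact ⟨e, rfl⟩
  refine ⟨d, hd, 2 ^ d, by positivity, le_rfl, fun a ↦ ?_⟩
  have hpow (i : ℕ) : a ^ 2 ^ (i + 1) = a ^ 2 ^ i * a ^ 2 ^ i := by
    rw [pow_succ, pow_mul, pow_two]
  obtain ⟨i, hi, h⟩ := exists_eq_of_topologicalKrullDim_eq hd
    (fun i ↦ closureMulPoint ξ (a ^ 2 ^ i))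
    (antitone_nat_of_succ_le fun i ↦ hpow i ▸ closureMulPoint_mul_self_le hξ _)
  -- Points of a scheme with the same closure coincide, as the space is T0.
  have heq : (mulPoint (a ^ 2 ^ (i + 1))).left ξ = (mulPoint (a ^ 2 ^ i)).left ξ :=
    (inseparable_iff_closure_eq.mpr congr(($h : Set S.left))).eq
  have hgl := isGroupLike_of_mulPoint_apply_eq (hξ _) (a ^ 2 ^ i)
    (by rw [← heq, ← pow_mul, ← pow_succ])
  -- The index `i` depends on `a`; passing to the power `2 ^ d` makes the exponent uniform.
  obtain ⟨k, rfl⟩ := Nat.exists_eq_add_of_le hi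
  rw [pow_add, pow_mul]
  exact hgl.pow _
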